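/- Let $\mathcal X$ be a measurable space and $\mathcal Y=\{\pm1\}$. Let $\mathcal F$ be a class of measurable functions $\mathcal X\to\mathcal Y$ of finite VC dimension $d$, and let $P$ be a probability distribution on $\mathcal X\times\mathcal Y$ with marginal $P_X$ on $\mathcal X$. Assume the usual measurability condition on $\mathcal F$: for every $n$ and $v\in\mathcal Y^n$, the set $\{x\in\mathcal X^n:\exists f\in\mathcal F\ \forall i\ f(x_i)=v_i\}$ is $P_X^n$-null-measurable. Write $R(f)=\Pr_{(X,Y)\sim P}(f(X)\ne Y)$, and for a sample $S_m=((x_1,y_1),\dots,(x_m,y_m))$ write $\hat R(f)=\frac1m\sum_i \mathbb 1\{f(x_i)\neq y_i\}$. For $G\subseteq\mathcal F$ let $DIS(G)=\{x:\exists f_1,f_2\in G,\ f_1(x)\ne f_2(x)\}$, and for $f \in \mathcal F$, $r_0>0$ let $$\theta_f(r_0)=\sup_{r>r_0}\frac{P_X(DIS(B(f,r)))}{r},\qquad B(f,r)=\{f'\in\mathcal F:P_X(f'\ne f)\le r\}.$$ ILESS$(S_m,\delta,\mathcal F,d)$ is the following algorithm. Put $a=\frac{4d}{m}\ln\frac{16me}{d\delta}$,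 let $\hat f\in\mathcal F$ be any minimizer of $\hat R$ over $\mathcal F$, put $s=a+\sqrt{a\hat R(\hat f)}$ and $\sigma=s+a+\sqrt{a(\hat R(\hat f)+s)}$, and let $G=\{f\in\mathcal F:\hat R(f)\le\hat R(\hat f)+\sigma\}$. The output is the selective classifier $(\hat f,g)$ with $g(x)=1$ if $x\notin DIS(G)$ and $g(x)=0$ otherwise. Its abstain rate is $1-\Phi$ with $\Phi=P_X(g(X)=1)$. Let ${\rm polylog}(x,d,y)$ be a function that is nonnegative for $x,y>0$ and nondecreasing in $x$ and in $y$ for $x,y\ge1$. Suppose that there is an integer $m_{\max}\ge1$ such that for every $1\le m\le m_{\max}$ and every $\delta\in(0,1)$, with probability at least $1-\delta$ over $S_m\sim P^m$, the abstain rate of ILESS$(S_m,\delta,\mathcal F,d)$ satisfies $$1-\Phi\le\frac{{\rm polylog}(m,d,1/\delta)}{m}.$$ Then for every minimizer $f^*$ of $R$ over $\mathcal F$ and every $r\ge 1/m_{\max}$ such that $d\,r^2\le16$ or $r\ge\frac1{24}$, $$\theta_{f^*}(r)\le 8\left({\rm polylog}(1/r,d,1/r)+3\right).$$ -/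

import Mathlib

open MeasureTheory

/-! Binary labels are modelled by `Bool`, a hypothesis is a function `X → Bool`, a hypothesis class
is a set of such functions, and a labelled sample of size `m` is a function `Fin m → X × Bool`. -/

section Learning

variable {X : Type*}

/-- The class `F` shatters the finite set `s`: every labelling of `s` is realised by some `f ∈ F`. -/
def ClassShatters (F : Set (X → Bool)) (s : Finset X) : Prop :=
  ∀ v : X → Bool, ∃ f ∈ F, ∀ x ∈ s, f x = v x

/-- The VC dimension of `F` is finite and equal to `d`: the largest cardinality of a finite set
shattered by `F` exists and is `d`. -/
def HasVCDim (F : Set (X → Bool)) (d : ℕ) : Prop :=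
  IsGreatest {n : ℕ | ∃ s : Finset X, s.card = n ∧ ClassShatters F s} d

/-- The empirical zero-one error of `f` on the sample `S`. -/
noncomputable def empRisk {m : ℕ} (S : Fin m → X × Bool) (f : X → Bool) : ℝ :=
  (1 / (m : ℝ)) * ∑ i, if f (S i).1 ≠ (S i).2 then 1 else 0

/-- `f` is an empirical risk minimizer of the class `F` on the sample `S`. -/
def IsERM {m : ℕ} (F : Set (X → Bool)) (S : Fin m → X × Bool) (f : X → Bool) : Prop :=
  f ∈ F ∧ ∀ f' ∈ F, empRisk S f ≤ empRisk S f'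

/-- The empirical low-error set around `f` of radius `r`. -/
def empLowErrorSet {m : ℕ} (F : Set (X → Bool)) (S : Fin m → X × Bool) (f : X → Bool) (r : ℝ) :
    Set (X → Bool) :=
  {f' | f' ∈ F ∧ empRisk S f' ≤ empRisk S f + r}

/-- The disagreement set of `G`. -/
def disagreementSet (G : Set (X → Bool)) : Set X :=
  {x | ∃ f₁ ∈ G, ∃ f₂ ∈ G, f₁ x ≠ f₂ x}

/-- The quantity `4 d ln (16 m e / (d δ)) / m` that occurs in the slack terms. -/
noncomputable def slackBase (m : ℕ) (δ : ℝ) (d : ℕ) : ℝ :=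
  4 * (d : ℝ) * Real.log (16 * (m : ℝ) * Real.exp 1 / ((d : ℝ) * δ)) / (m : ℝ)

/-- The empirical slack for bounding the true error by the empirical error `Rhat`. -/
noncomputable def slackTrueEmp (m : ℕ) (δ : ℝ) (d : ℕ) (Rhat : ℝ) : ℝ :=
  slackBase m δ d + Real.sqrt (slackBase m δ d * Rhat)

/-- The non-empirical slack for bounding the empirical error by the true error `R`. -/
noncomputable def slackEmpTrue (m : ℕ) (δ : ℝ) (d : ℕ) (R : ℝ) : ℝ :=
  slackBase m δ d + Real.sqrt (slackBase m δ d * R)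

/-- The radius used by ILESS, as a function of the empirical error `Rhat` of the ERM. -/
noncomputable def ilessRadius (m : ℕ) (δ : ℝ) (d : ℕ) (Rhat : ℝ) : ℝ :=
  slackTrueEmp m δ d Rhat + slackEmpTrue m δ d (Rhat + slackTrueEmp m δ d Rhat)

/-- A selective classifier `(f, g)`: it outputs `f x` if `g x = true` and abstains otherwise. -/
structure SelectiveClassifier (X : Type*) where
  /-- the classifier -/
  classifier : X → Bool
  /-- the selection function -/
  selection : X → Bool

open Classical in
/-- The output of ILESS on the sample `S` with confidence parameter `δ`, class `F` and VC dimension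
`d`, when the empirical risk minimizer that it computes is `fhat`. -/
noncomputable def iless {m : ℕ} (S : Fin m → X × Bool) (δ : ℝ) (F : Set (X → Bool)) (d : ℕ)
    (fhat : X → Bool) : SelectiveClassifier X where
  classifier := fhat
  selection := fun x =>
    decide (x ∉ disagreementSet
      (empLowErrorSet F S fhat (ilessRadius m δ d (empRisk S fhat))))

variable [MeasurableSpace X]

/-- The true zero-one error of `f` under the distribution `P` on `X × Bool`. -/
noncomputable def trueRisk (P : Measure (X × Bool)) (f : X → Bool) : ℝ :=
  P.real {z | f z.1 ≠ z.2}

/-- `f` is a true risk minimizer of the class `F` under `P`. -/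
def IsTrueRiskMinimizer (F : Set (X → Bool)) (P : Measure (X × Bool)) (f : X → Bool) : Prop :=
  f ∈ F ∧ ∀ f' ∈ F, trueRisk P f ≤ trueRisk P f'

/-- The coverage of a selective classifier under the marginal distribution `μ`. -/
noncomputable def SelectiveClassifier.coverage (c : SelectiveClassifier X) (μ : Measure X) : ℝ :=
  μ.real {x | c.selection x = true}

/-- The abstain rate of a selective classifier under the marginal distribution `μ`. -/
noncomputable def SelectiveClassifier.abstainRate (c : SelectiveClassifier X) (μ : Measure X) : ℝ :=
  1 - c.coverage μ

/-- The ball of radius `r` around `f` in the class `F`, for the disagreement pseudometric of `μ`. -/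
def hypBall (F : Set (X → Bool)) (μ : Measure X) (f : X → Bool) (r : ℝ) : Set (X → Bool) :=
  {f' | f' ∈ F ∧ μ.real {x | f' x ≠ f x} ≤ r}

/-- Hanneke's disagreement coefficient `θ_f(r₀)`, the supremum over `r > r₀` of the mass of the
disagreement set of the ball of radius `r` around `f`, divided by `r`; it is used for `0 < r₀` and
takes values in `[0, ∞]`, so that the supremum is a genuine one. -/
noncomputable def disagreementCoeff (F : Set (X → Bool)) (μ : Measure X) (f : X → Bool) (r₀ : ℝ) :
    ENNReal :=
  ⨆ (r : ℝ) (_ : r₀ < r), μ (disagreementSet (hypBall F μ f r)) / ENNReal.ofReal r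

/-- The usual measurability proviso of uniform convergence over a possibly uncountable class: for
every `n` and every pattern of `n` labels, the set of `n`-tuples of points on which some member of
the class realises the pattern is measurable up to null sets. It holds for countable classes, for
pointwise separable classes, and for image admissible Suslin classes. -/
def PatternMeasurable (F : Set (X → Bool)) (μ : Measure X) : Prop :=
  ∀ (n : ℕ) (v : Fin n → Bool),
    NullMeasurableSet {x : Fin n → X | ∃ f ∈ F, ∀ i, f (x i) = v i}
      (Measure.pi fun _ : Fin n => μ)

end Learning

/-! Fix `ρ > r`. If some sample size `m` and confidence `δ` are such that the ball of radius `ρ`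
around the risk minimizer `f*` lies in the low-error set `G` with probability more than `δ`, then
this event meets the event of the abstain guarantee, which has probability at least `1 - δ`. On a
common sample the disagreement region of the ball is abstained on, so its mass is at most `polylog /
m`. With `m ≥ 1 / (8ρ)` this is at most `8ρ` times the polylogarithmic term. The guarantee is thus
used at one pair `(m, δ)` for each `ρ`, and the inclusion is only needed with probability slightly
above one half.

The inclusion is `measure_not_subset_empLowErrorSet_lt`, for `δ = ρ` and `m` about `1 / (8ρ)`. It
rests on `measure_not_comparable_le`. A member of the ball differs from `f*` on few sample points,
since a ghost sample most likely shows no difference at all. And `f*` cannot do much worse on the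
sample than another `g`, since its count concentrates by Chebyshev and a ghost sample would reveal
the larger true risk of `g`. Both use the symmetrized bound `measure_rootExcessEvent_le`, in which
differences of square roots of counts give the relative form of the ILESS radius.

If `d ρ²` is large, the logarithm in the slack may be small. Then `δ` and `m` are chosen so that the
slack is at least `1/2`; the ILESS radius exceeds 1 and `G` is the whole class. -/

/-! ### Random signs and random swaps -/

open Classical in
/-- Hoeffding's inequality for weighted sums of independent random signs, in counting form. -/
theorem card_signs_le_exp {ι : Type*} [Fintype ι] (c : ι → ℝ) (K t : ℝ) (hK : 0 < K) (ht : 0 ≤ t)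
    (hc : ∑ i, c i ^ 2 ≤ K) :
    ((Finset.univ.filter fun τ : ι → Bool =>
      t * √K ≤ ∑ i, if τ i then c i else -c i).card : ℝ)
      ≤ 2 ^ Fintype.card ι * Real.exp (-t ^ 2 / 2) := by
  -- The Chernoff parameter: `t / √K` minimizes `l² K / 2 - l t √K`.
  set l := t / √K with hl
  have hsK : 0 < √K := Real.sqrt_pos.2 hK
  have hmgf : ∑ τ : ι → Bool, Real.exp (l * ∑ i, if τ i then c i else -c i)
      ≤ 2 ^ Fintype.card ι * Real.exp (t ^ 2 / 2) := by
    have h1 : ∀ τ : ι → Bool, Real.exp (l * ∑ i, if τ i then c i else -c i)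
        = ∏ i, Real.exp (l * if τ i then c i else -c i) := by
      intro τ; rw [Finset.mul_sum, Real.exp_sum]
    have h2 : ∑ τ : ι → Bool, ∏ i, Real.exp (l * if τ i then c i else -c i)
        = ∏ i, ∑ b : Bool, Real.exp (l * if b then c i else -c i) := by
      rw [Finset.prod_univ_sum, Fintype.piFinset_univ]
    simp_rw [h1]
    rw [h2]
    calc ∏ i, ∑ b : Bool, Real.exp (l * if b then c i else -c i)
        ≤ ∏ i, (2 * Real.exp ((l * c i) ^ 2 / 2)) := by
          refine Finset.prod_le_prod (fun i _ => by positivity) fun i _ => ?_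
          have := Real.cosh_le_exp_half_sq (l * c i)
          rw [Real.cosh_eq] at this
          simp only [Fintype.sum_bool, if_true, Bool.false_eq_true, if_false, mul_neg]
          linarith
      _ = 2 ^ Fintype.card ι * Real.exp (∑ i, (l * c i) ^ 2 / 2) := by
          rw [Finset.prod_mul_distrib, Real.exp_sum]; simp
      _ ≤ _ := by
          gcongr
          rw [← Finset.sum_div]
          simp_rw [mul_pow]
          rw [← Finset.mul_sum]
          have : l ^ 2 * K = t ^ 2 := by
            rw [hl, div_pow, Real.sq_sqrt hK.le]; field_simp
          have : l ^ 2 * ∑ i, c i ^ 2 ≤ t ^ 2 := by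
            rw [← this]; gcongr
          linarith
  have hmarkov : ((Finset.univ.filter fun τ : ι → Bool =>
      t * √K ≤ ∑ i, if τ i then c i else -c i).card : ℝ) * Real.exp (t ^ 2)
      ≤ ∑ τ : ι → Bool, Real.exp (l * ∑ i, if τ i then c i else -c i) := by
    rw [← nsmul_eq_mul, ← Finset.sum_const]
    refine le_trans (Finset.sum_le_sum (g := fun τ => Real.exp (l * ∑ i, if τ i then c i else -c i))
      fun τ hτ => ?_) (Finset.sum_le_sum_of_subset_of_nonneg (Finset.filter_subset _ _)
        fun _ _ _ => (Real.exp_pos _).le)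
    rw [Finset.mem_filter] at hτ
    have hl0 : 0 ≤ l := by positivity
    refine Real.exp_le_exp.2 ?_
    have := mul_le_mul_of_nonneg_left hτ.2 hl0
    have h3 : l * (t * √K) = t ^ 2 := by rw [hl]; field_simp
    linarith
  have h4 : Real.exp (-t ^ 2 / 2) * Real.exp (t ^ 2) = Real.exp (t ^ 2 / 2) := by
    rw [← Real.exp_add]; congr 1; ring
  have h5 := hmarkov.trans hmgf
  rw [← h4, ← mul_assoc] at h5
  exact le_of_mul_le_mul_right h5 (Real.exp_pos _)

/-- Exchange the two copies of `i` for each `i` with `τ i = true`. -/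
def swapCopies {ι : Type*} (τ : ι → Bool) : Equiv.Perm (ι ⊕ ι) :=
  Function.Involutive.toPerm
    (fun j => Sum.elim (fun i => if τ i then Sum.inr i else Sum.inl i)
      (fun i => if τ i then Sum.inl i else Sum.inr i) j) (by
    intro j
    rcases j with i | i <;> by_cases h : τ i <;> simp [h])

theorem swapCopies_inl {ι : Type*} (τ : ι → Bool) (i : ι) :
    swapCopies τ (Sum.inl i) = if τ i then Sum.inr i else Sum.inl i := rfl

theorem swapCopies_inr {ι : Type*} (τ : ι → Bool) (i : ι) :
    swapCopies τ (Sum.inr i) = if τ i then Sum.inl i else Sum.inr i := rfl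

/-- The excess of the root of the number of marked points of the second half of a double sample
over that of the first half. -/
noncomputable def rootExcess {ι : Type*} [Fintype ι] (e : ι ⊕ ι → Bool) : ℝ :=
  √((Finset.univ.filter fun i => e (Sum.inr i) = true).card : ℝ)
    - √((Finset.univ.filter fun i => e (Sum.inl i) = true).card : ℝ)

/-- If `a` and `b` are the two counts, `√a - √b ≥ t` gives `a - b ≥ t (√a + √b) ≥ t √(a + b)`. The
total `a + b = K` is invariant under swaps and `a - b` is a signed sum whose squared weights add up
to at most `K`, so Hoeffding's bound is free of `K`. -/
theorem card_swaps_rootExcess_le {ι : Type*} [Fintype ι] [DecidableEq ι] (e : ι ⊕ ι → Bool) (t : ℝ) (ht : 0 < t) :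
    ({τ : ι → Bool | t ≤ rootExcess (e ∘ swapCopies τ)}.ncard : ℝ)
      ≤ 2 ^ Fintype.card ι * Real.exp (-t ^ 2 / 2) := by
  classical
  set ind : ι ⊕ ι → ℝ := fun j => if e j then 1 else 0 with hind
  set K : ℝ := ∑ i, (ind (Sum.inl i) + ind (Sum.inr i)) with hKdef
  set c : ι → ℝ := fun i => ind (Sum.inl i) - ind (Sum.inr i) with hcdef
  have hcard : ∀ τ : ι → Bool,
      ((Finset.univ.filter fun i => (e ∘ swapCopies τ) (Sum.inr i) = true).card : ℝ)
        = ∑ i, ind (swapCopies τ (Sum.inr i)) ∧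
      ((Finset.univ.filter fun i => (e ∘ swapCopies τ) (Sum.inl i) = true).card : ℝ)
        = ∑ i, ind (swapCopies τ (Sum.inl i)) := by
    intro τ; constructor <;> simp [hind]
  have key : ∀ τ : ι → Bool, t ≤ rootExcess (e ∘ swapCopies τ) →
      0 < K ∧ t * √K ≤ ∑ i, if τ i then c i else -c i := by
    intro τ h
    unfold rootExcess at h
    rw [(hcard τ).1, (hcard τ).2] at h
    set a := ∑ i, ind (swapCopies τ (Sum.inr i)) with ha
    set b := ∑ i, ind (swapCopies τ (Sum.inl i)) with hb
    have hind0 : ∀ j, 0 ≤ ind j := fun j => by simp only [hind]; split_ifs <;> norm_num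
    have ha0 : 0 ≤ a := Finset.sum_nonneg fun _ _ => hind0 _
    have hb0 : 0 ≤ b := Finset.sum_nonneg fun _ _ => hind0 _
    have hab : a + b = K := by
      rw [ha, hb, hKdef, ← Finset.sum_add_distrib]
      refine Finset.sum_congr rfl fun i _ => ?_
      rw [swapCopies_inl, swapCopies_inr]
      split_ifs <;> ring
    have hdiff : a - b = ∑ i, if τ i then c i else -c i := by
      rw [ha, hb, ← Finset.sum_sub_distrib]
      refine Finset.sum_congr rfl fun i _ => ?_
      rw [swapCopies_inl, swapCopies_inr, hcdef]
      split_ifs <;> ring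
    have hsa : 0 < √a := by have := Real.sqrt_nonneg b; linarith
    have hapos : 0 < a := Real.sqrt_pos.1 hsa
    refine ⟨by linarith, ?_⟩
    rw [← hdiff, ← hab]
    have h1 : √(a + b) ≤ √a + √b := by
      rw [Real.sqrt_le_left (by positivity)]
      nlinarith [Real.sq_sqrt ha0, Real.sq_sqrt hb0, Real.sqrt_nonneg a, Real.sqrt_nonneg b,
        mul_nonneg (Real.sqrt_nonneg a) (Real.sqrt_nonneg b)]
    calc t * √(a + b) ≤ (√a - √b) * (√a + √b) := by
          exact mul_le_mul h h1 (Real.sqrt_nonneg _) (ht.le.trans h)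
      _ = √a ^ 2 - √b ^ 2 := by ring
      _ = a - b := by rw [Real.sq_sqrt ha0, Real.sq_sqrt hb0]
  by_cases hK : 0 < K
  · have hcK : ∑ i, c i ^ 2 ≤ K := by
      rw [hKdef]
      refine Finset.sum_le_sum fun i _ => ?_
      simp only [hcdef, hind]
      split_ifs <;> norm_num
    refine le_trans ?_ (card_signs_le_exp c K t hK ht.le hcK)
    rw [← Set.ncard_coe_finset]
    refine Nat.cast_le.2 (Set.ncard_le_ncard (fun τ hτ => ?_) (Finset.finite_toSet _))
    simpa using (key τ hτ).2
  · have : {τ : ι → Bool | t ≤ rootExcess (e ∘ swapCopies τ)} = ∅ := by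
      ext τ; simp only [Set.mem_ofPred_eq, Set.mem_empty_iff_false, iff_false]
      exact fun h => hK (key τ h).1
    rw [this]; simp; positivity

/-! ### Growth function -/

/-- The labellings of the points `x` that are realised by the class `F`. -/
def labellings {X ι : Type*} (F : Set (X → Bool)) (x : ι → X) : Set (ι → Bool) :=
  {v | ∃ f ∈ F, ∀ i, f (x i) = v i}

/-- For `k ≤ d ≤ n` the factor `(n/d)^d (d/n)^k` is at least 1. Inserting it and completing the sum
gives `(n/d)^d (1 + d/n)^n`. -/
theorem sum_choose_le_exp_pow (n d : ℕ) (hd : 1 ≤ d) (hdn : d ≤ n) :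
    (∑ k ∈ Finset.Iic d, (n.choose k : ℝ)) ≤ (Real.exp 1 * n / d) ^ d := by
  have hd' : (0 : ℝ) < d := by exact_mod_cast hd
  have hn' : (0 : ℝ) < n := by exact_mod_cast hd.trans hdn
  have hq : (1 : ℝ) ≤ n / d := by rw [le_div_iff₀ hd']; simpa using (by exact_mod_cast hdn : (d : ℝ) ≤ n)
  calc (∑ k ∈ Finset.Iic d, (n.choose k : ℝ))
      ≤ ∑ k ∈ Finset.Iic d, (n / d : ℝ) ^ d * ((d / n : ℝ) ^ k * n.choose k) := by
        refine Finset.sum_le_sum fun k hk => ?_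
        have hkd : k ≤ d := Finset.mem_Iic.1 hk
        have : (1 : ℝ) ≤ (n / d : ℝ) ^ d * (d / n : ℝ) ^ k := by
          have h1 : (d / n : ℝ) ^ k = ((n / d : ℝ) ^ k)⁻¹ := by rw [← inv_pow, inv_div]
          rw [h1, ← div_eq_mul_inv, one_le_div (by positivity)]
          exact pow_le_pow_right₀ hq hkd
        rw [← mul_assoc]
        exact le_mul_of_one_le_left (by positivity) this
    _ = (n / d : ℝ) ^ d * ∑ k ∈ Finset.Iic d, ((d / n : ℝ) ^ k * n.choose k) := by
        rw [Finset.mul_sum]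
    _ ≤ (n / d : ℝ) ^ d * ∑ k ∈ Finset.range (n + 1), ((d / n : ℝ) ^ k * n.choose k) := by
        refine mul_le_mul_of_nonneg_left (Finset.sum_le_sum_of_subset_of_nonneg (fun k hk => ?_)
          fun _ _ _ => by positivity) (by positivity)
        simp only [Finset.mem_Iic, Finset.mem_range] at *; omega
    _ = (n / d : ℝ) ^ d * (d / n + 1 : ℝ) ^ n := by rw [add_pow]; simp
    _ ≤ (n / d : ℝ) ^ d * (Real.exp (d / n : ℝ)) ^ n := by
        gcongr; exact Real.add_one_le_exp _
    _ = (Real.exp 1 * n / d) ^ d := by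
        rw [← Real.exp_nat_mul, mul_div_cancel₀ _ hn'.ne', mul_div_assoc, mul_pow, ← Real.exp_nat_mul]
        simp [mul_comm]

/-- The Sauer–Shelah lemma for the labellings of a sample. -/
theorem ncard_labellings_le {X ι : Type*} [Fintype ι] [DecidableEq ι] (F : Set (X → Bool)) (d : ℕ)
    (hd : HasVCDim F d) (x : ι → X) :
    (labellings F x).ncard ≤ ∑ k ∈ Finset.Iic d, (Fintype.card ι).choose k := by
  classical
  let supp : (ι → Bool) → Finset ι := fun v => Finset.univ.filter fun i => v i = true
  have hinj : Function.Injective supp := by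
    intro v w h
    funext i
    have := congrArg (fun s => i ∈ s) h
    simp only [supp, Finset.mem_filter, Finset.mem_univ, true_and, eq_iff_iff] at this
    exact Bool.eq_iff_iff.2 this
  let 𝒜 : Finset (Finset ι) := (Set.toFinite (labellings F x)).toFinset.image supp
  have hcard : (labellings F x).ncard = 𝒜.card := by
    rw [Finset.card_image_of_injective _ hinj, Set.ncard_eq_toFinset_card _ (Set.toFinite _)]
  have hvc : 𝒜.vcDim ≤ d := by
    refine Finset.sup_le fun s hs => ?_
    have hs := Finset.mem_shatterer.1 hs
    have hreal : ∀ t ⊆ s, ∃ f ∈ F, ∀ i ∈ s, f (x i) = true ↔ i ∈ t := by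
      intro t ht
      obtain ⟨u, hu, hut⟩ := hs ht
      obtain ⟨v, hv, rfl⟩ := Finset.mem_image.1 hu
      obtain ⟨f, hf, hfv⟩ := (Set.Finite.mem_toFinset _).1 hv
      refine ⟨f, hf, fun i hi => ?_⟩
      rw [hfv i, ← hut]
      simp [supp, hi]
    -- Sample points may repeat, but not on a shattered set of indices: the singleton `{i}` is cut
    -- out by some hypothesis. Shattering of indices therefore passes to points without loss of
    -- cardinality.
    have hxinj : Set.InjOn x s := by
      intro i hi j hj hij
      obtain ⟨f, -, hf⟩ := hreal {i} (by simpa using hi)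
      have h1 := (hf i hi).2 (by simp)
      rw [hij] at h1
      exact (Finset.mem_singleton.1 ((hf j hj).1 h1)).symm
    refine hd.2 ⟨s.image x, Finset.card_image_of_injOn hxinj, fun v => ?_⟩
    obtain ⟨f, hf, hfv⟩ := hreal (s.filter fun i => v (x i) = true) (Finset.filter_subset _ _)
    refine ⟨f, hf, fun y hy => ?_⟩
    obtain ⟨i, hi, rfl⟩ := Finset.mem_image.1 hy
    have := hfv i hi
    simp only [Finset.mem_filter, hi, true_and] at this
    exact Bool.eq_iff_iff.2 this
  rw [hcard]
  refine (𝒜.card_le_card_shatterer.trans Finset.card_shatterer_le_sum_vcDim).trans ?_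
  exact Finset.sum_le_sum_of_subset (Finset.Iic_subset_Iic.2 hvc)

/-! ### Null-measurability of label patterns -/

theorem measurePreserving_comp_equiv {Z ι κ : Type*} [MeasurableSpace Z] [Fintype ι] [Fintype κ]
    (μ : Measure Z) [SigmaFinite μ] (e : ι ≃ κ) :
    MeasurePreserving (fun ω : κ → Z => ω ∘ e) (Measure.pi fun _ => μ) (Measure.pi fun _ => μ) := by
  have hm : Measurable fun ω : κ → Z => ω ∘ e :=
    measurable_pi_iff.2 fun i => measurable_pi_apply (e i)
  refine ⟨hm, (Measure.pi_eq fun s hs => ?_).symm⟩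
  rw [Measure.map_apply hm (MeasurableSet.univ_pi hs)]
  have : (fun ω : κ → Z => ω ∘ e) ⁻¹' Set.univ.pi s = Set.univ.pi fun k => s (e.symm k) := by
    ext ω
    simp only [Set.mem_preimage, Set.mem_pi, Set.mem_univ, true_implies, Function.comp]
    exact ⟨fun h k => by simpa using h (e.symm k), fun h i => by simpa using h (e i)⟩
  rw [this, Measure.pi_pi]
  exact e.symm.prod_comp fun i => μ (s i)

theorem PatternMeasurable.nullMeasurableSet_fintype {X ι : Type*} [MeasurableSpace X] [Fintype ι]
    {F : Set (X → Bool)} {μ : Measure X} [SigmaFinite μ] (h : PatternMeasurable F μ)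
    (v : ι → Bool) :
    NullMeasurableSet {x : ι → X | v ∈ labellings F x} (Measure.pi fun _ => μ) := by
  let e := (Fintype.equivFin ι).symm
  have := (h (Fintype.card ι) (v ∘ e)).preimage
    (measurePreserving_comp_equiv μ e).quasiMeasurePreserving
  convert this using 1
  ext x
  simp only [labellings, Set.mem_ofPred_eq, Set.mem_preimage, Function.comp]
  refine exists_congr fun f => and_congr_right fun _ => ?_
  exact ⟨fun h i => h (e i), fun h i => by simpa using h (e.symm i)⟩

theorem PatternMeasurable.nullMeasurableSet_sample {X ι : Type*} [MeasurableSpace X] [Fintype ι]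
    {F : Set (X → Bool)} {P : Measure (X × Bool)} [IsProbabilityMeasure P]
    (h : PatternMeasurable F P.fst) (v : ι → Bool) :
    NullMeasurableSet {ω : ι → X × Bool | v ∈ labellings F fun i => (ω i).1}
      (Measure.pi fun _ => P) := by
  have h1 : MeasurePreserving (fun (ω : ι → X × Bool) i => (ω i).1)
      (Measure.pi fun _ => P) (Measure.pi fun _ => P.fst) :=
    measurePreserving_pi _ _ fun _ => ⟨measurable_fst, rfl⟩
  exact (h.nullMeasurableSet_fintype v).preimage h1.quasiMeasurePreserving

theorem ae_nullMeasurableSet_section {α β : Type*} [MeasurableSpace α] [MeasurableSpace β]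
    {μ : Measure α} {ν : Measure β} [SFinite ν] {E : Set (α × β)}
    (h : NullMeasurableSet E (μ.prod ν)) :
    ∀ᵐ a ∂μ, NullMeasurableSet {b | (a, b) ∈ E} ν := by
  obtain ⟨E', hE', hEE'⟩ := h
  filter_upwards [Measure.ae_ae_of_ae_prod hEE'] with a ha
  refine ⟨{b | (a, b) ∈ E'}, measurable_prodMk_left hE', ?_⟩
  filter_upwards [ha] with b hb
  exact hb

/-- For almost every sample, the points at which a given label extends a given labelling of the
sample form a null-measurable set. -/
theorem PatternMeasurable.ae_nullMeasurableSet_extension {X ι : Type*} [MeasurableSpace X]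
    [Fintype ι] {F : Set (X → Bool)} {P : Measure (X × Bool)} [IsProbabilityMeasure P]
    (h : PatternMeasurable F P.fst) :
    ∀ᵐ S ∂(Measure.pi fun _ : ι => P), ∀ (v : ι → Bool) (b : Bool),
      NullMeasurableSet {x | ∃ f ∈ F, (∀ i, f (S i).1 = v i) ∧ f x = b} P.fst := by
  have h1 : MeasurePreserving (fun (ω : ι → X × Bool) i => (ω i).1)
      (Measure.pi fun _ => P) (Measure.pi fun _ => P.fst) :=
    measurePreserving_pi _ _ fun _ => ⟨measurable_fst, rfl⟩
  -- The extra point becomes one more coordinate, so that the extension set is a section of a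
  -- pattern set.
  have h2 : MeasurePreserving (fun p : (ι → X) × X => Sum.elim p.1 (fun _ : Unit => p.2))
      ((Measure.pi fun _ => P.fst).prod P.fst) (Measure.pi fun _ => P.fst) := by
    have a := measurePreserving_sumPiEquivProdPi_symm (X := fun _ : ι ⊕ Unit => X)
      (fun _ => P.fst)
    have b := (measurePreserving_funUnique P.fst Unit).symm
    have c := a.comp ((MeasurePreserving.id (Measure.pi fun _ : ι => P.fst)).prod b)
    convert c using 1
    funext p j
    rcases j with i | i <;> rfl
  rw [ae_all_iff]; intro v
  rw [ae_all_iff]; intro b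
  have h3 := ae_nullMeasurableSet_section
    ((h.nullMeasurableSet_fintype (Sum.elim v fun _ : Unit => b)).preimage
      h2.quasiMeasurePreserving)
  filter_upwards [h1.quasiMeasurePreserving.ae h3] with S hS
  convert hS using 1
  ext x
  simp [labellings, Sum.forall]

/-! ### Ghost samples and symmetrization -/

/-- Markov's inequality for sections, without any measurability. -/
theorem mul_measure_section_ge_le {α β : Type*} [MeasurableSpace α] [MeasurableSpace β]
    (μ : Measure α) (ν : Measure β) [SFinite μ] [SFinite ν] (E : Set (α × β)) (p : ENNReal) :
    p * μ {a | p ≤ ν {b | (a, b) ∈ E}} ≤ (μ.prod ν) E := by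
  set E' := toMeasurable (μ.prod ν) E with hE'
  have hm : MeasurableSet E' := measurableSet_toMeasurable _ _
  calc p * μ {a | p ≤ ν {b | (a, b) ∈ E}}
      ≤ p * μ {a | p ≤ ν (Prod.mk a ⁻¹' E')} := by
        refine mul_le_mul_right (measure_mono fun a ha => ?_) p
        exact le_trans (b := ν {b | (a, b) ∈ E}) ha
          (measure_mono fun b hb => subset_toMeasurable _ _ hb)
    _ ≤ ∫⁻ a, ν (Prod.mk a ⁻¹' E') ∂μ := mul_meas_ge_le_lintegral (measurable_measure_prodMk_left hm) p
    _ = (μ.prod ν) E' := (Measure.prod_apply hm).symm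
    _ = (μ.prod ν) E := measure_toMeasurable _

open Classical in
/-- The number of points of a finite family on which `f` differs from the reference labelling
`h`. -/
noncomputable def mistakeCount {X ι : Type*} [Fintype ι] (h : X × Bool → Bool) (f : X → Bool)
    (S : ι → X × Bool) : ℝ :=
  ((Finset.univ.filter fun i => f (S i).1 ≠ h (S i)).card : ℝ)

/-- The double samples on whose second half some member of `F` makes many more mistakes than on the
first half. -/
def rootExcessEvent {X ι : Type*} [Fintype ι] (F : Set (X → Bool)) (h : X × Bool → Bool) (t : ℝ) :
    Set (ι ⊕ ι → X × Bool) :=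
  {ω | ∃ f ∈ F, t ≤ √(mistakeCount h f fun i => ω (Sum.inr i))
    - √(mistakeCount h f fun i => ω (Sum.inl i))}

/-- Membership depends on `f` only through its labelling of the double sample, so the possibly
uncountable class is replaced by finitely many labellings. -/
theorem mem_rootExcessEvent_iff {X ι : Type*} [Fintype ι] (F : Set (X → Bool))
    (h : X × Bool → Bool) (t : ℝ) (ω : ι ⊕ ι → X × Bool) :
    ω ∈ rootExcessEvent F h t ↔ ∃ v ∈ labellings F fun i => (ω i).1,
      t ≤ rootExcess fun j => v j ^^ h (ω j) := by
  have hx : ∀ (f : X → Bool) (v : ι ⊕ ι → Bool), (∀ i, f (ω i).1 = v i) →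
      √(mistakeCount h f fun i => ω (Sum.inr i)) - √(mistakeCount h f fun i => ω (Sum.inl i))
        = rootExcess fun j => v j ^^ h (ω j) := by
    intro f v hfv
    unfold mistakeCount rootExcess
    simp [hfv]
  constructor
  · rintro ⟨f, hf, hft⟩
    exact ⟨fun i => f (ω i).1, ⟨f, hf, fun _ => rfl⟩, by rwa [← hx f _ fun _ => rfl]⟩
  · rintro ⟨v, ⟨f, hf, hfv⟩, ht⟩
    exact ⟨f, hf, by rwa [hx f v hfv]⟩

theorem nullMeasurableSet_rootExcessEvent {X ι : Type*} [MeasurableSpace X] [Fintype ι]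
    {F : Set (X → Bool)} {P : Measure (X × Bool)} [IsProbabilityMeasure P]
    (hFP : PatternMeasurable F P.fst) {h : X × Bool → Bool} (hh : Measurable h) (t : ℝ) :
    NullMeasurableSet (rootExcessEvent F h t : Set (ι ⊕ ι → X × Bool))
      (Measure.pi fun _ => P) := by
  classical
  have : (rootExcessEvent F h t : Set (ι ⊕ ι → X × Bool)) = ⋃ v : ι ⊕ ι → Bool,
      {ω | v ∈ labellings F fun i => (ω i).1} ∩
        (fun ω i => h (ω i)) ⁻¹' {w | t ≤ rootExcess fun j => v j ^^ w j} := by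
    ext ω
    simp [mem_rootExcessEvent_iff]
  rw [this]
  refine NullMeasurableSet.iUnion fun v => (hFP.nullMeasurableSet_sample v).inter ?_
  have hm : Measurable fun (ω : ι ⊕ ι → X × Bool) i => h (ω i) :=
    measurable_pi_iff.2 fun i => hh.comp (measurable_pi_apply i)
  exact (hm (Set.toFinite _).measurableSet).nullMeasurableSet

/-- Symmetrization: the mass of the excess event is at most the growth function times the
Rademacher tail. -/
theorem measure_rootExcessEvent_le {X ι : Type*} [MeasurableSpace X] [Fintype ι] [DecidableEq ι]
    {F : Set (X → Bool)} {P : Measure (X × Bool)} [IsProbabilityMeasure P]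
    (hFP : PatternMeasurable F P.fst) {h : X × Bool → Bool} (hh : Measurable h)
    {N : ℝ} (hN : ∀ x : ι ⊕ ι → X, ((labellings F x).ncard : ℝ) ≤ N) {t : ℝ} (ht : 0 < t) :
    (Measure.pi fun _ : ι ⊕ ι => P) (rootExcessEvent F h t)
      ≤ ENNReal.ofReal (N * Real.exp (-t ^ 2 / 2)) := by
  classical
  set μ := Measure.pi fun _ : ι ⊕ ι => P with hμ
  set E : Set (ι ⊕ ι → X × Bool) := rootExcessEvent F h t with hE
  have hEm : NullMeasurableSet E μ := nullMeasurableSet_rootExcessEvent hFP hh t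
  let φ : (ι → Bool) → (ι ⊕ ι → X × Bool) → (ι ⊕ ι → X × Bool) := fun τ ω => ω ∘ swapCopies τ
  have hφ : ∀ τ, MeasurePreserving (φ τ) μ μ := fun τ => measurePreserving_comp_equiv P _
  have hpoint : ∀ ω, ({τ : ι → Bool | φ τ ω ∈ E}.ncard : ℝ)
      ≤ 2 ^ Fintype.card ι * (N * Real.exp (-t ^ 2 / 2)) := by
    intro ω
    set V := (Set.toFinite (labellings F fun i => (ω i).1)).toFinset with hV
    let T : (ι ⊕ ι → Bool) → Set (ι → Bool) := fun v =>
      {τ | t ≤ rootExcess ((fun j => v j ^^ h (ω j)) ∘ swapCopies τ)}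
    -- Swapping permutes the points of `ω`, so the labellings in `V` serve every `τ` at once, and
    -- the union bound has at most `N` terms.
    have hsub : {τ : ι → Bool | φ τ ω ∈ E} ⊆ ⋃ v ∈ V, T v := by
      intro τ hτ
      obtain ⟨v, ⟨f, hf, hfv⟩, hv⟩ := (mem_rootExcessEvent_iff F h t _).1 hτ
      simp only [Set.mem_iUnion]
      refine ⟨fun i => f (ω i).1, ?_, ?_⟩
      · rw [hV, Set.Finite.mem_toFinset]; exact ⟨f, hf, fun _ => rfl⟩
      · refine hv.trans_eq (congrArg rootExcess ?_)
        funext j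
        simp [φ, ← hfv]
    calc ({τ : ι → Bool | φ τ ω ∈ E}.ncard : ℝ)
        ≤ ((⋃ v ∈ V, T v).ncard : ℝ) := by
          exact_mod_cast Set.ncard_le_ncard hsub (Set.toFinite _)
      _ ≤ ∑ v ∈ V, ((T v).ncard : ℝ) := by
          exact_mod_cast Finset.set_ncard_biUnion_le V T
      _ ≤ ∑ v ∈ V, 2 ^ Fintype.card ι * Real.exp (-t ^ 2 / 2) :=
          Finset.sum_le_sum fun v _ => card_swaps_rootExcess_le _ t ht
      _ = V.card * (2 ^ Fintype.card ι * Real.exp (-t ^ 2 / 2)) := by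
          rw [Finset.sum_const, nsmul_eq_mul]
      _ ≤ N * (2 ^ Fintype.card ι * Real.exp (-t ^ 2 / 2)) := by
          gcongr
          rw [hV, ← Set.ncard_eq_toFinset_card]
          exact hN _
      _ = _ := by ring
  have hsum : (2 ^ Fintype.card ι : ENNReal) * μ E
      ≤ 2 ^ Fintype.card ι * ENNReal.ofReal (N * Real.exp (-t ^ 2 / 2)) := by
    calc (2 ^ Fintype.card ι : ENNReal) * μ E
        = ∑ τ : ι → Bool, μ (φ τ ⁻¹' E) := by
          simp_rw [fun τ => (hφ τ).measure_preimage hEm]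
          simp
      _ = ∑ τ : ι → Bool, ∫⁻ ω, (φ τ ⁻¹' E).indicator 1 ω ∂μ := by
          refine Finset.sum_congr rfl fun τ _ => ?_
          rw [lintegral_indicator_one₀ (hEm.preimage (hφ τ).quasiMeasurePreserving)]
      _ = ∫⁻ ω, ∑ τ : ι → Bool, (φ τ ⁻¹' E).indicator 1 ω ∂μ := by
          rw [lintegral_finsetSum']
          exact fun τ _ => aemeasurable_one.indicator₀
            (hEm.preimage (hφ τ).quasiMeasurePreserving)
      _ ≤ ∫⁻ _, ENNReal.ofReal (2 ^ Fintype.card ι * (N * Real.exp (-t ^ 2 / 2))) ∂μ := by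
          refine lintegral_mono fun ω => ?_
          have h1 : ∑ τ : ι → Bool, (φ τ ⁻¹' E).indicator (1 : (ι ⊕ ι → X × Bool) → ENNReal) ω
              = ENNReal.ofReal ({τ : ι → Bool | φ τ ω ∈ E}.ncard : ℝ) := by
            rw [ENNReal.ofReal_natCast, Set.ncard_eq_toFinset_card']
            simp [Set.indicator_apply]
          rw [h1]
          exact ENNReal.ofReal_le_ofReal (hpoint ω)
      _ = 2 ^ Fintype.card ι * ENNReal.ofReal (N * Real.exp (-t ^ 2 / 2)) := by
          rw [lintegral_const, measure_univ, mul_one, ENNReal.ofReal_mul (by positivity),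
            ENNReal.ofReal_pow (by norm_num)]
          simp
  exact (ENNReal.mul_le_mul_iff_right (by simp) (by simp)).1 hsum

/-- With `p = 1/2`, a bound for the double sample becomes twice that bound for the samples that half
of the ghosts expose. Root excess is one-sided, so a sample with too few mistakes is taken as first
half, as here, and one with too many as second half, as in `mul_measure_ghost_first_le`. -/
theorem mul_measure_ghost_second_le {Z ι : Type*} [MeasurableSpace Z] [Fintype ι]
    (P : Measure Z) [SigmaFinite P] (E : Set (ι ⊕ ι → Z)) (p : ENNReal) :
    p * (Measure.pi fun _ : ι => P)
        {S | p ≤ (Measure.pi fun _ : ι => P) {S' | Sum.elim S S' ∈ E}}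
      ≤ (Measure.pi fun _ : ι ⊕ ι => P) E := by
  have h := measurePreserving_sumPiEquivProdPi_symm (X := fun _ : ι ⊕ ι => Z) (fun _ => P)
  rw [← h.measure_preimage_equiv]
  exact mul_measure_section_ge_le (Measure.pi fun _ : ι => P) (Measure.pi fun _ : ι => P)
    ((fun q => Sum.elim q.1 q.2) ⁻¹' E) p

theorem mul_measure_ghost_first_le {Z ι : Type*} [MeasurableSpace Z] [Fintype ι]
    (P : Measure Z) [SigmaFinite P] (E : Set (ι ⊕ ι → Z)) (p : ENNReal) :
    p * (Measure.pi fun _ : ι => P)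
        {S | p ≤ (Measure.pi fun _ : ι => P) {S' | Sum.elim S' S ∈ E}}
      ≤ (Measure.pi fun _ : ι ⊕ ι => P) E := by
  have h := measurePreserving_sumPiEquivProdPi_symm (X := fun _ : ι ⊕ ι => Z) (fun _ => P)
  have h2 : MeasurePreserving (MeasurableEquiv.prodComm (α := ι → Z) (β := ι → Z))
      ((Measure.pi fun _ : ι => P).prod (Measure.pi fun _ : ι => P))
      ((Measure.pi fun _ : ι => P).prod (Measure.pi fun _ : ι => P)) :=
    Measure.measurePreserving_swap
  rw [← h.measure_preimage_equiv, ← h2.measure_preimage_equiv]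
  exact mul_measure_section_ge_le (Measure.pi fun _ : ι => P) (Measure.pi fun _ : ι => P)
    ((fun q => Sum.elim q.2 q.1) ⁻¹' E) p

/-! ### Concentration of a single mistake count -/

section Counting

variable {X ι : Type*} [MeasurableSpace X] [Fintype ι] {P : Measure (X × Bool)}
  [IsProbabilityMeasure P] {h : X × Bool → Bool} {f : X → Bool}

theorem measurableSet_mistake (hh : Measurable h) (hf : Measurable f) :
    MeasurableSet {z : X × Bool | f z.1 ≠ h z} :=
  (measurableSet_eq_fun (hf.comp measurable_fst) hh).compl

theorem measure_mistakeCount_ne_zero_le (hh : Measurable h) (hf : Measurable f) :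
    (Measure.pi fun _ : ι => P) {S | mistakeCount h f S ≠ 0}
      ≤ ENNReal.ofReal (Fintype.card ι * P.real {z | f z.1 ≠ h z}) := by
  have hD := measurableSet_mistake hh hf
  have hsub : {S : ι → X × Bool | mistakeCount h f S ≠ 0}
      ⊆ ⋃ i, (fun S => S i) ⁻¹' {z | f z.1 ≠ h z} := by
    intro S hS
    by_contra hcon
    refine hS ?_
    simp only [Set.mem_iUnion, not_exists] at hcon
    have hcon : ∀ i, f (S i).1 = h (S i) := fun i => by simpa using hcon i
    simp [mistakeCount, hcon]
  refine (measure_mono hsub).trans ((measure_iUnion_le _).trans_eq ?_)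
  rw [tsum_fintype]
  have : ∀ i : ι, (Measure.pi fun _ : ι => P) ((fun S => S i) ⁻¹' {z | f z.1 ≠ h z})
      = P {z | f z.1 ≠ h z} := fun i =>
    (measurePreserving_eval (fun _ : ι => P) i).measure_preimage hD.nullMeasurableSet
  simp_rw [this]
  rw [ENNReal.ofReal_mul (by positivity), ofReal_measureReal]
  simp

theorem measure_le_abs_mistakeCount_sub_le (hh : Measurable h) (hf : Measurable f) {c : ℝ}
    (hc : 0 < c) :
    (Measure.pi fun _ : ι => P)
        {S | c ≤ |mistakeCount h f S - Fintype.card ι * P.real {z | f z.1 ≠ h z}|}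
      ≤ ENNReal.ofReal (Fintype.card ι * P.real {z | f z.1 ≠ h z} / c ^ 2) := by
  classical
  set D := {z : X × Bool | f z.1 ≠ h z} with hDdef
  have hD : MeasurableSet D := measurableSet_mistake hh hf
  set Y : X × Bool → ℝ := D.indicator 1 with hY
  have hYm : MemLp Y 2 P := (memLp_const (1 : ℝ)).indicator hD
  have hcount : ∀ S : ι → X × Bool, mistakeCount h f S = (∑ i, fun ω : ι → X × Bool => Y (ω i)) S := by
    intro S
    simp only [mistakeCount, Finset.card_filter, Finset.sum_apply, hY, Set.indicator_apply, hDdef]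
    simp
  have hYi : ∀ i : ι, MemLp (fun ω : ι → X × Bool => Y (ω i)) 2 (Measure.pi fun _ => P) := fun i =>
    hYm.comp_measurePreserving (measurePreserving_eval (fun _ : ι => P) i)
  have hmean : (∫ S, (∑ i, fun ω : ι → X × Bool => Y (ω i)) S ∂(Measure.pi fun _ : ι => P))
      = Fintype.card ι * P.real D := by
    simp_rw [Finset.sum_apply]
    rw [integral_finsetSum _ fun i _ => (hYi i).integrable (by norm_num)]
    have : ∀ i : ι, ∫ S, Y (S i) ∂(Measure.pi fun _ : ι => P) = P.real D := by
      intro i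
      rw [integral_comp_eval (μ := fun _ : ι => P) (i := i) hYm.aestronglyMeasurable, hY,
        integral_indicator_one hD]
    simp_rw [this]
    simp
  have hvar : ProbabilityTheory.variance (∑ i, fun ω : ι → X × Bool => Y (ω i))
      (Measure.pi fun _ : ι => P) ≤ Fintype.card ι * P.real D := by
    rw [ProbabilityTheory.variance_sum_pi (X := fun _ : ι => Y) fun _ => hYm]
    have : ProbabilityTheory.variance Y P ≤ P.real D := by
      refine (ProbabilityTheory.variance_le_expectation_sq hYm.aestronglyMeasurable).trans_eq ?_
      rw [← integral_indicator_one hD]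
      congr 1
      funext z
      simp only [Pi.pow_apply, hY, Set.indicator_apply]
      split_ifs <;> simp
    calc _ ≤ ∑ i : ι, P.real D := Finset.sum_le_sum fun _ _ => this
      _ = _ := by simp
  have := ProbabilityTheory.meas_ge_le_variance_div_sq
    (memLp_finsetSum' Finset.univ fun i _ => hYi i) hc
  rw [hmean] at this
  simp_rw [hcount]
  refine this.trans (ENNReal.ofReal_le_ofReal ?_)
  gcongr

/-- With probability at least one half, the root of the number of mistakes is close to the root of
its mean. -/
theorem measure_sqrt_mistakeCount_far_le_half (hh : Measurable h) (hf : Measurable f) :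
    (Measure.pi fun _ : ι => P)
        {S | ¬ (√(mistakeCount h f S) ≤ √(Fintype.card ι * P.real {z | f z.1 ≠ h z}) + √2 / 2 ∧
          √(Fintype.card ι * P.real {z | f z.1 ≠ h z}) - √2 ≤ √(mistakeCount h f S))}
      ≤ ENNReal.ofReal (1 / 2) := by
  set M := Fintype.card ι * P.real {z | f z.1 ≠ h z} with hM
  have hM0 : 0 ≤ M := by positivity
  have h2 : √2 ^ 2 = (2 : ℝ) := Real.sq_sqrt (by norm_num)
  have h2' : 0 < √2 := by positivity
  have hsM := Real.sq_sqrt hM0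
  -- The variance is at most `M`, so Chebyshev with `c = √2 √M` fails with probability at most one
  -- half. For `M = 0` any positive `c ≤ 1/2` works.
  obtain ⟨c, hc, hMc, hcup, hclow⟩ : ∃ c : ℝ, 0 < c ∧ M / c ^ 2 ≤ 1 / 2 ∧
      M + c ≤ (√M + √2 / 2) ^ 2 ∧ (√M ≤ √2 ∨ (√M - √2) ^ 2 ≤ M - c) := by
    rcases hM0.eq_or_lt with h0 | h0
    · refine ⟨1 / 2, by norm_num, ?_, ?_, Or.inl ?_⟩
      · rw [← h0]; norm_num
      · rw [← h0]; simp; nlinarith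
      · rw [← h0]; simp
    · have hs : 0 < √M := Real.sqrt_pos.2 h0
      refine ⟨√2 * √M, by positivity, ?_, ?_, ?_⟩
      · rw [mul_pow, h2, hsM]; apply le_of_eq; field_simp
      · nlinarith
      · rcases le_total √M √2 with h3 | h3
        · exact Or.inl h3
        · right; nlinarith
  refine (measure_mono fun S hS => ?_).trans ((measure_le_abs_mistakeCount_sub_le hh hf hc).trans
    (ENNReal.ofReal_le_ofReal hMc))
  by_contra hcon
  refine hS ?_
  have habs : |mistakeCount h f S - M| < c := not_le.1 hcon
  obtain ⟨ha, hb⟩ := abs_lt.1 habs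
  constructor
  · exact Real.sqrt_le_iff.2 ⟨by positivity, by linarith⟩
  · rcases hclow with h3 | h3
    · have := Real.sqrt_nonneg (mistakeCount h f S); linarith
    · exact Real.le_sqrt_of_sq_le (by linarith)

end Counting

/-! ### Uniform comparison of empirical errors -/

theorem mistakeCount_le_add {X ι : Type*} [Fintype ι] (h : X × Bool → Bool) (f g : X → Bool)
    (S : ι → X × Bool) :
    mistakeCount h f S ≤ mistakeCount h g S + mistakeCount (fun z => g z.1) f S := by
  classical
  unfold mistakeCount
  norm_cast
  refine (Finset.card_le_card fun i hi => ?_).trans (Finset.card_union_le _ _)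
  simp only [Finset.mem_union, Finset.mem_filter, Finset.mem_univ, true_and] at hi ⊢
  by_cases hfg : f (S i).1 = g (S i).1
  · left; rwa [← hfg]
  · right; exact hfg

/-- Uniform deviation bound: with probability at least about one half, every member of the class
close to the risk minimizer has an empirical error comparable to that of every other member. -/
theorem measure_not_comparable_le {X : Type*} [MeasurableSpace X] {F : Set (X → Bool)}
    (hF : ∀ f ∈ F, Measurable f) {P : Measure (X × Bool)} [IsProbabilityMeasure P]
    (hFP : PatternMeasurable F P.fst) {fstar : X → Bool} (hstar : IsTrueRiskMinimizer F P fstar)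
    {m : ℕ} {A N ρ : ℝ} (hA : 54 ≤ A) (hN0 : 0 ≤ N) (hρ : m * ρ ≤ 1 / 6)
    (hN : ∀ x : Fin m ⊕ Fin m → X, ((labellings F x).ncard : ℝ) ≤ N) :
    (Measure.pi fun _ : Fin m => P) {S | ¬ ∀ f ∈ hypBall F P.fst fstar ρ, ∀ g ∈ F,
        mistakeCount Prod.snd f S ≤ mistakeCount Prod.snd g S + 2 * A
          + 2 * √(A * mistakeCount Prod.snd g S)}
      ≤ ENNReal.ofReal (1 / 2 + 4 * (N * Real.exp (-A / 4))) := by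
  set μ := Measure.pi fun _ : Fin m => P with hμ
  set t := √(A / 2) with ht
  have ht0 : 0 < t := Real.sqrt_pos.2 (by linarith)
  have ht2 : t ^ 2 = A / 2 := Real.sq_sqrt (by linarith)
  have hexp : -t ^ 2 / 2 = -A / 4 := by rw [neg_div, ht2]; ring
  have hfs : Measurable fstar := hF _ hstar.1
  have hfs' : Measurable fun z : X × Bool => fstar z.1 := hfs.comp measurable_fst
  set β := N * Real.exp (-A / 4) with hβ
  have hβ0 : 0 ≤ β := by positivity
  set M : ℝ := m * trueRisk P fstar with hM
  -- The two Chebyshev losses, `√2 / 2` for `f*` on the sample and `√2` for `g` on the ghost, must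
  -- fit into `√A - √(A / 2)`. This requires `A` above about 52.5, hence the assumption `54 ≤ A`.
  have hgap : t ≤ √A - √2 / 2 - √2 := by
    have h2 : √2 ^ 2 = (2 : ℝ) := Real.sq_sqrt (by norm_num)
    have hA2 : √A ^ 2 = A := Real.sq_sqrt (by linarith)
    have h2l : (1.41 : ℝ) ≤ √2 := Real.le_sqrt_of_sq_le (by norm_num)
    have h2u : √2 ≤ (1.415 : ℝ) := Real.sqrt_le_iff.2 ⟨by norm_num, by norm_num⟩
    have hsA : (7.34 : ℝ) ≤ √A := Real.le_sqrt_of_sq_le (by norm_num; linarith)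
    refine Real.sqrt_le_iff.2 ⟨by linarith, ?_⟩
    nlinarith
  set A₀ : Set (Fin m → X × Bool) :=
    {S | ¬ (√(mistakeCount Prod.snd fstar S) ≤ √M + √2 / 2 ∧
      √M - √2 ≤ √(mistakeCount Prod.snd fstar S))} with hA₀
  set B₁ : Set (Fin m → X × Bool) := {S | ENNReal.ofReal (1 / 2) ≤
    μ {S' | Sum.elim S S' ∈ rootExcessEvent F Prod.snd t}} with hB₁
  set B₂ : Set (Fin m → X × Bool) := {S | ENNReal.ofReal (1 / 2) ≤
    μ {S' | Sum.elim S' S ∈ rootExcessEvent F (fun z => fstar z.1) t}} with hB₂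
  have hA₀le : μ A₀ ≤ ENNReal.ofReal (1 / 2) := by
    have := measure_sqrt_mistakeCount_far_le_half (ι := Fin m) (P := P) measurable_snd hfs
    rw [Fintype.card_fin] at this
    exact this
  have hdouble : ∀ x : ENNReal, ENNReal.ofReal (1 / 2) * x ≤ ENNReal.ofReal β →
      x ≤ ENNReal.ofReal (2 * β) := by
    intro x hx
    calc x = ENNReal.ofReal 2 * (ENNReal.ofReal (1 / 2) * x) := by
          rw [← mul_assoc, ← ENNReal.ofReal_mul (by norm_num)]; norm_num
      _ ≤ ENNReal.ofReal 2 * ENNReal.ofReal β := by gcongr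
      _ = _ := (ENNReal.ofReal_mul (by norm_num)).symm
  have hB₁le : μ B₁ ≤ ENNReal.ofReal (2 * β) := by
    refine hdouble _ ((mul_measure_ghost_second_le P _ _).trans ?_)
    have := measure_rootExcessEvent_le hFP measurable_snd hN ht0
    rwa [hexp] at this
  have hB₂le : μ B₂ ≤ ENNReal.ofReal (2 * β) := by
    refine hdouble _ ((mul_measure_ghost_first_le P _ _).trans ?_)
    have := measure_rootExcessEvent_le hFP hfs' hN ht0
    rwa [hexp] at this
  have hcompl : ∀ B : Set (Fin m → X × Bool), μ Bᶜ ≤ ENNReal.ofReal (1 / 2) →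
      ENNReal.ofReal (1 / 2) ≤ μ B := by
    intro B hB
    have h1 : (1 : ENNReal) ≤ μ B + ENNReal.ofReal (1 / 2) := by
      calc (1 : ENNReal) = μ (B ∪ Bᶜ) := by rw [Set.union_compl_self, measure_univ]
        _ ≤ μ B + μ Bᶜ := measure_union_le _ _
        _ ≤ _ := by gcongr
    have h2 : (1 : ENNReal) = ENNReal.ofReal (1 / 2) + ENNReal.ofReal (1 / 2) := by
      rw [← ENNReal.ofReal_add (by norm_num) (by norm_num)]; norm_num
    rw [h2] at h1
    exact (ENNReal.add_le_add_iff_right ENNReal.ofReal_ne_top).1 h1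
  have hnn : ∀ (h : X × Bool → Bool) (f : X → Bool) (S : Fin m → X × Bool),
      0 ≤ mistakeCount h f S := fun _ _ _ => Nat.cast_nonneg _
  -- As `m ρ ≤ 1/6`, the ghost shows no disagreement with `f*` with probability at least one half.
  -- More than `A / 2 = t²` disagreements on `S` would then be a root excess of `t`.
  have hclose : ∀ S ∉ B₂, ∀ f ∈ hypBall F P.fst fstar ρ,
      mistakeCount (fun z => fstar z.1) f S ≤ A / 2 := by
    intro S hS f hf
    by_contra hcon
    refine hS (hcompl _ ?_)
    have hmf := hF f hf.1
    have hreal : P.real {z | f z.1 ≠ fstar z.1} ≤ ρ := by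
      refine le_of_eq_of_le ?_ hf.2
      rw [measureReal_def, measureReal_def, Measure.fst_apply]
      · rfl
      · exact (measurableSet_eq_fun hmf hfs).compl
    refine (measure_mono fun S' hS' => ?_).trans
      ((measure_mistakeCount_ne_zero_le hfs' hmf).trans (ENNReal.ofReal_le_ofReal
        (q := 1 / 2) ?_))
    · intro h0
      refine hS' ⟨f, hf.1, ?_⟩
      simp only [Sum.elim_inl, Sum.elim_inr]
      rw [h0, Real.sqrt_zero, sub_zero]
      exact Real.sqrt_le_sqrt (not_le.1 hcon).le
    · rw [Fintype.card_fin]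
      have : (m : ℝ) * P.real {z | f z.1 ≠ fstar z.1} ≤ m * ρ := by gcongr
      linarith
  -- If this fails, the root count of `g` on `S` is at least `√A` below that of `f*`, which is near
  -- `√M`. The ghost count of `g` has mean at least `M`, so at least half of the ghosts show an
  -- excess.
  have hlow : ∀ S ∉ A₀, S ∉ B₁ → ∀ g ∈ F, mistakeCount Prod.snd fstar S
      ≤ mistakeCount Prod.snd g S + 3 / 2 * A + 2 * √(A * mistakeCount Prod.snd g S) := by
    intro S hSA hSB g hg
    by_contra hcon
    refine hSB (hcompl _ ?_)
    have hSA : √(mistakeCount Prod.snd fstar S) ≤ √M + √2 / 2 := (not_not.1 hSA).1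
    have hroot : √(mistakeCount Prod.snd g S) + √A ≤ √(mistakeCount Prod.snd fstar S) := by
      refine Real.le_sqrt_of_sq_le ?_
      rw [not_le, Real.sqrt_mul (by linarith)] at hcon
      have h1 := Real.sq_sqrt (hnn Prod.snd g S)
      have h2 : √A ^ 2 = A := Real.sq_sqrt (by linarith)
      nlinarith
    have hrisk : √M ≤ √(m * P.real {z | g z.1 ≠ z.2}) := by
      refine Real.sqrt_le_sqrt ?_
      have := hstar.2 g hg
      rw [hM]
      exact mul_le_mul_of_nonneg_left this (Nat.cast_nonneg _)
    have hghost := measure_sqrt_mistakeCount_far_le_half (ι := Fin m) (P := P) measurable_snd (hF g hg)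
    rw [Fintype.card_fin] at hghost
    refine (measure_mono fun S' hS' => ?_).trans hghost
    rintro ⟨-, h4⟩
    refine hS' ⟨g, hg, ?_⟩
    simp only [Sum.elim_inl, Sum.elim_inr]
    linarith
  calc μ _ ≤ μ (A₀ ∪ (B₁ ∪ B₂)) := by
        refine measure_mono fun S hS => ?_
        by_contra hcon
        simp only [Set.mem_union, not_or] at hcon
        refine hS fun f hf g hg => ?_
        have h1 := hclose S hcon.2.2 f hf
        have h2 := hlow S hcon.1 hcon.2.1 g hg
        have h3 := mistakeCount_le_add Prod.snd f fstar S
        linarith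
    _ ≤ μ A₀ + (μ B₁ + μ B₂) :=
        (measure_union_le _ _).trans (add_le_add_right (measure_union_le _ _) _)
    _ ≤ ENNReal.ofReal (1 / 2) + (ENNReal.ofReal (2 * β) + ENNReal.ofReal (2 * β)) := by gcongr
    _ ≤ _ := by
        rw [← ENNReal.ofReal_add (by linarith) (by linarith),
          ← ENNReal.ofReal_add (by norm_num) (by linarith)]
        exact ENNReal.ofReal_le_ofReal (by linarith)

/-! ### Slack terms and the ILESS radius -/

/-- The constant 16 in the slack is calibrated for this: the product is exactly `(δ / 8)^d`. -/
theorem growth_mul_exp_neg_slack_le {m d : ℕ} {δ : ℝ} (hm : 1 ≤ m) (hd : 1 ≤ d) (hδ : 0 < δ)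
    (hδ1 : δ < 1) :
    (Real.exp 1 * (2 * m : ℕ) / d) ^ d *
        Real.exp (-(4 * d * Real.log (16 * m * Real.exp 1 / (d * δ))) / 4) ≤ δ / 8 := by
  have hd' : (0 : ℝ) < d := by exact_mod_cast hd
  have hm' : (0 : ℝ) < m := by exact_mod_cast hm
  set Y := 16 * m * Real.exp 1 / (d * δ) with hY
  have hYpos : 0 < Y := by positivity
  have h1 : Real.exp (-(4 * d * Real.log Y) / 4) = Y⁻¹ ^ d := by
    rw [show -(4 * d * Real.log Y) / 4 = d * (-Real.log Y) by ring, Real.exp_nat_mul,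
      Real.exp_neg, Real.exp_log hYpos]
  rw [h1, ← mul_pow]
  have h2 : Real.exp 1 * (2 * m : ℕ) / d * Y⁻¹ = δ / 8 := by
    rw [hY]; push_cast; field_simp; norm_num
  rw [h2]
  exact pow_le_of_le_one (by positivity) (by linarith) (by omega)

theorem mul_empRisk_eq {X : Type*} {m : ℕ} (hm : 1 ≤ m) (S : Fin m → X × Bool) (f : X → Bool) :
    m * empRisk S f = mistakeCount Prod.snd f S := by
  have hm' : (m : ℝ) ≠ 0 := by positivity
  unfold empRisk mistakeCount
  rw [← mul_assoc, mul_one_div_cancel hm', one_mul, Finset.card_filter]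
  push_cast
  refine Finset.sum_congr rfl fun i _ => ?_
  congr

theorem empRisk_nonneg {X : Type*} {m : ℕ} (S : Fin m → X × Bool) (f : X → Bool) :
    0 ≤ empRisk S f := by
  unfold empRisk
  refine mul_nonneg (by positivity) (Finset.sum_nonneg fun i _ => ?_)
  split_ifs <;> norm_num

theorem empRisk_le_one {X : Type*} {m : ℕ} (hm : 1 ≤ m) (S : Fin m → X × Bool) (f : X → Bool) :
    empRisk S f ≤ 1 := by
  have hm' : (0 : ℝ) < m := by exact_mod_cast hm
  have h := mul_empRisk_eq hm S f
  have h2 : mistakeCount Prod.snd f S ≤ m := by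
    unfold mistakeCount
    exact_mod_cast (Finset.card_le_univ _).trans_eq (Fintype.card_fin m)
  rw [← h] at h2
  exact le_of_mul_le_mul_left (by linarith) hm'

theorem le_ilessRadius {m d : ℕ} {δ R : ℝ} (ha : 0 ≤ slackBase m δ d) :
    2 * slackBase m δ d + 2 * √(slackBase m δ d * R) ≤ ilessRadius m δ d R := by
  unfold ilessRadius slackEmpTrue slackTrueEmp
  set a := slackBase m δ d
  have h0 := Real.sqrt_nonneg (a * R)
  have h : √(a * R) ≤ √(a * (R + (a + √(a * R)))) := by
    refine Real.sqrt_le_sqrt ?_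
    gcongr
    linarith
  linarith

/-! ### From the abstain rate to the disagreement mass -/

/-- Membership in the low-error set depends only on the labelling of `S`. The points that receive a
given label thus form a finite union of extension sets. -/
theorem nullMeasurableSet_disagreementSet {X : Type*} [MeasurableSpace X] {F : Set (X → Bool)}
    {μ : Measure X} {m : ℕ} {S : Fin m → X × Bool}
    (h : ∀ (v : Fin m → Bool) (b : Bool),
      NullMeasurableSet {x | ∃ f ∈ F, (∀ i, f (S i).1 = v i) ∧ f x = b} μ) (f₀ : X → Bool) (ρ : ℝ) :
    NullMeasurableSet (disagreementSet (empLowErrorSet F S f₀ ρ)) μ := by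
  set G := empLowErrorSet F S f₀ ρ with hG
  have hb : ∀ b : Bool, NullMeasurableSet {x | ∃ f ∈ G, f x = b} μ := by
    intro b
    have : {x | ∃ f ∈ G, f x = b} = ⋃ v ∈ {v : Fin m → Bool | ∃ g ∈ G, ∀ i, g (S i).1 = v i},
        {x | ∃ f ∈ F, (∀ i, f (S i).1 = v i) ∧ f x = b} := by
      ext x
      simp only [Set.mem_iUnion, Set.mem_ofPred_eq]
      constructor
      · rintro ⟨f, hf, hfx⟩
        exact ⟨fun i => f (S i).1, ⟨f, hf, fun _ => rfl⟩, f, hf.1, fun _ => rfl, hfx⟩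
      · rintro ⟨v, ⟨g, hg, hgv⟩, f, hf, hfv, hfx⟩
        refine ⟨f, ⟨hf, le_of_eq_of_le ?_ hg.2⟩, hfx⟩
        simp [empRisk, hfv, hgv]
    rw [this]
    exact NullMeasurableSet.biUnion (Set.to_countable _) fun v _ => h v b
  have : disagreementSet G = {x | ∃ f ∈ G, f x = true} ∩ {x | ∃ f ∈ G, f x = false} := by
    ext x
    constructor
    · rintro ⟨f, hf, g, hg, hfg⟩
      cases h1 : f x <;> cases h2 : g x <;> simp [h1, h2] at hfg
      · exact ⟨⟨g, hg, h2⟩, f, hf, h1⟩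
      · exact ⟨⟨f, hf, h1⟩, g, hg, h2⟩
    · rintro ⟨⟨f, hf, h1⟩, g, hg, h2⟩
      exact ⟨f, hf, g, hg, by simp [h1, h2]⟩
  rw [this]
  exact (hb true).inter (hb false)

/-- Null-measurability is what identifies one minus the coverage with the mass of the disagreement
set. -/
theorem measure_disagreementSet_le_of_abstainRate {X : Type*} [MeasurableSpace X]
    {F : Set (X → Bool)} {μ : Measure X} [IsProbabilityMeasure μ] {m d : ℕ} {S : Fin m → X × Bool}
    {δ q : ℝ} {fhat : X → Bool} {H : Set (X → Bool)}
    (hm : NullMeasurableSet (disagreementSet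
      (empLowErrorSet F S fhat (ilessRadius m δ d (empRisk S fhat)))) μ)
    (hH : H ⊆ empLowErrorSet F S fhat (ilessRadius m δ d (empRisk S fhat)))
    (hq : (iless S δ F d fhat).abstainRate μ ≤ q) :
    μ (disagreementSet H) ≤ ENNReal.ofReal q := by
  set D := disagreementSet (empLowErrorSet F S fhat (ilessRadius m δ d (empRisk S fhat))) with hD
  have hcov : (iless S δ F d fhat).abstainRate μ = μ.real D := by
    have : {x | (iless S δ F d fhat).selection x = true} = Dᶜ := by
      ext x; simp [iless, hD]
    unfold SelectiveClassifier.abstainRate SelectiveClassifier.coverage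
    rw [this, measureReal_def, measureReal_def, prob_compl_eq_one_sub₀ hm,
      ENNReal.toReal_sub_of_le prob_le_one ENNReal.one_ne_top]
    simp
  have hsub : disagreementSet H ⊆ D := by
    rintro x ⟨f, hf, g, hg, hfg⟩
    exact ⟨f, hH hf, g, hH hg, hfg⟩
  refine (measure_mono hsub).trans ?_
  rw [← ofReal_measureReal]
  exact ENNReal.ofReal_le_ofReal (hcov ▸ hq)

/-- If a class of hypotheses is contained in the low-error set with probability more than `δ`, then
the abstain rate bounds the mass of its disagreement set. -/
theorem measure_disagreementSet_le {X : Type*} [MeasurableSpace X] {F : Set (X → Bool)}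
    {P : Measure (X × Bool)} [IsProbabilityMeasure P] (hFP : PatternMeasurable F P.fst)
    {m d : ℕ} {δ q : ℝ} (erm : (Fin m → X × Bool) → X → Bool) {H : Set (X → Bool)}
    (hq : 1 - δ ≤ (Measure.pi fun _ : Fin m => P).real
      {S | (iless S δ F d (erm S)).abstainRate P.fst ≤ q})
    (hH : (Measure.pi fun _ : Fin m => P) {S | ¬ H ⊆ empLowErrorSet F S (erm S)
      (ilessRadius m δ d (empRisk S (erm S)))} < ENNReal.ofReal (1 - δ)) :
    P.fst (disagreementSet H) ≤ ENNReal.ofReal q := by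
  set μ := Measure.pi fun _ : Fin m => P
  by_contra hcon
  have hae := hFP.ae_nullMeasurableSet_extension (ι := Fin m)
  set Z : Set (Fin m → X × Bool) := {S | ¬ ∀ (v : Fin m → Bool) (b : Bool),
      NullMeasurableSet {x | ∃ f ∈ F, (∀ i, f (S i).1 = v i) ∧ f x = b} P.fst} with hZ
  have hZ0 : μ Z = 0 := hae
  have hsub : {S | (iless S δ F d (erm S)).abstainRate P.fst ≤ q} ⊆
      {S | ¬ H ⊆ empLowErrorSet F S (erm S) (ilessRadius m δ d (empRisk S (erm S)))} ∪ Z := by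
    intro S hS
    by_contra hS'
    simp only [Set.mem_union, not_or, hZ, Set.mem_ofPred_eq, not_not] at hS'
    exact hcon (measure_disagreementSet_le_of_abstainRate
      (nullMeasurableSet_disagreementSet hS'.2 _ _) hS'.1 hS)
  have h1 : ENNReal.ofReal (1 - δ) ≤ μ {S | (iless S δ F d (erm S)).abstainRate P.fst ≤ q} := by
    rw [← ofReal_measureReal]; exact ENNReal.ofReal_le_ofReal hq
  have h2 := (measure_mono hsub).trans (measure_union_le (μ := μ) _ _)
  rw [hZ0, add_zero] at h2
  exact absurd (h1.trans h2) (not_le.2 hH)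

/-! ### The ball inside the low-error set -/

theorem subset_empLowErrorSet_of_half_le_slackBase {X : Type*} {F H : Set (X → Bool)} (hH : H ⊆ F)
    {m d : ℕ} (hm : 1 ≤ m) {δ : ℝ} (ha : 1 / 2 ≤ slackBase m δ d) (S : Fin m → X × Bool)
    (f : X → Bool) : H ⊆ empLowErrorSet F S f (ilessRadius m δ d (empRisk S f)) := by
  intro g hg
  refine ⟨hH hg, ?_⟩
  have h1 := le_ilessRadius (R := empRisk S f) (by linarith : 0 ≤ slackBase m δ d)
  have h2 := empRisk_le_one hm S g
  have h3 := empRisk_nonneg S f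
  have h4 := Real.sqrt_nonneg (slackBase m δ d * empRisk S f)
  linarith

theorem mem_empLowErrorSet_of_mistakeCount_le {X : Type*} {F : Set (X → Bool)} {m d : ℕ}
    (hm : 1 ≤ m) {δ A : ℝ} (hA0 : 0 ≤ A) (hA : A = m * slackBase m δ d) {S : Fin m → X × Bool}
    {f g : X → Bool} (hf : f ∈ F)
    (h : mistakeCount Prod.snd f S ≤ mistakeCount Prod.snd g S + 2 * A
      + 2 * √(A * mistakeCount Prod.snd g S)) :
    f ∈ empLowErrorSet F S g (ilessRadius m δ d (empRisk S g)) := by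
  have hm' : (0 : ℝ) < m := by exact_mod_cast hm
  refine ⟨hf, ?_⟩
  have ha : 0 ≤ slackBase m δ d := by
    rw [hA] at hA0; exact nonneg_of_mul_nonneg_right hA0 hm'
  have h1 := le_ilessRadius (R := empRisk S g) ha
  have h2 : √(A * mistakeCount Prod.snd g S) = m * √(slackBase m δ d * empRisk S g) := by
    rw [← mul_empRisk_eq hm, hA,
      show m * slackBase m δ d * (m * empRisk S g) = (m : ℝ) ^ 2 * (slackBase m δ d * empRisk S g)
        by ring, Real.sqrt_mul (by positivity), Real.sqrt_sq hm'.le]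
  rw [h2, ← mul_empRisk_eq hm, ← mul_empRisk_eq hm, hA] at h
  refine le_of_mul_le_mul_left (h.trans ?_) hm'
  have := mul_le_mul_of_nonneg_left h1 hm'.le
  linarith

theorem disagreementSet_eq_empty_of_hasVCDim_zero {X : Type*} {F : Set (X → Bool)}
    (hd : HasVCDim F 0) {H : Set (X → Bool)} (hH : H ⊆ F) : disagreementSet H = ∅ := by
  ext x
  simp only [Set.mem_empty_iff_false, iff_false]
  rintro ⟨f, hf, g, hg, hfg⟩
  have : (1 : ℕ) ≤ 0 := hd.2 ⟨{x}, Finset.card_singleton x, fun v => by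
    by_cases h : f x = v x
    · exact ⟨f, hH hf, by simpa using h⟩
    · refine ⟨g, hH hg, ?_⟩
      simp only [Finset.mem_singleton, forall_eq]
      revert h hfg
      cases f x <;> cases g x <;> cases v x <;> simp⟩
  omega

/-- For a sample much smaller than the inverse radius, and a slack that is not vacuous, the
logarithmic term of the slack is large. -/
theorem fourteen_le_log_of_slack {m d : ℕ} {δ : ℝ} (hd : 1 ≤ d) (hm : 1 ≤ m) (hδ : 0 < δ)
    (hmδ : m * δ ≤ 1 / 6) (hdδ : d * δ ≤ 16 * m)
    (hsmall : 8 * (d * Real.log (16 * m * Real.exp 1 / (d * δ))) ≤ m) :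
    14 ≤ Real.log (16 * m * Real.exp 1 / (d * δ)) := by
  have hd' : (1 : ℝ) ≤ d := by exact_mod_cast hd
  have hm' : (1 : ℝ) ≤ m := by exact_mod_cast hm
  set Y := 16 * m * Real.exp 1 / (d * δ) with hY
  set l := Real.log Y with hl
  have hYpos : 0 < Y := by positivity
  have he : (0 : ℝ) < Real.exp 1 := Real.exp_pos 1
  have hYe : Real.exp 1 ≤ Y := by
    rw [hY, le_div_iff₀ (by positivity)]
    nlinarith
  have hl1 : 1 ≤ l := (Real.le_log_iff_exp_le hYpos).2 hYe
  -- Bootstrap: `l ≥ s` forces `m ≥ 8 d s`, and with `m δ ≤ 1/6` this gives `Y ≥ 6144 e s²`, a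
  -- better lower bound for `l`. Two rounds, `1 → 9 → 14`, suffice for `A = 4 d l ≥ 54`.
  have step : ∀ s : ℝ, 1 ≤ s → s ≤ l → ∀ k : ℝ, Real.exp k ≤ 6144 * s ^ 2 → 1 + k ≤ l := by
    intro s hs1 hs k hk
    refine (Real.le_log_iff_exp_le hYpos).2 ?_
    rw [Real.exp_add]
    have h1 : 8 * (d * s) ≤ m := le_trans (by gcongr) hsmall
    have h2 : 6144 * s ^ 2 * (d * δ) ≤ 16 * m := by
      have h3 : 64 * s ^ 2 * d ≤ m ^ 2 := by
        calc 64 * s ^ 2 * (d : ℝ) ≤ 64 * s ^ 2 * d * d := le_mul_of_one_le_right (by positivity) hd'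
          _ = (8 * (d * s)) ^ 2 := by ring
          _ ≤ m ^ 2 := by gcongr
      calc 6144 * s ^ 2 * (d * δ) = 96 * (64 * s ^ 2 * d) * δ := by ring
        _ ≤ 96 * m ^ 2 * δ := by gcongr
        _ = 96 * m * (m * δ) := by ring
        _ ≤ 96 * m * (1 / 6) := by gcongr
        _ = 16 * m := by ring
    calc Real.exp 1 * Real.exp k ≤ Real.exp 1 * (6144 * s ^ 2) := by gcongr
      _ ≤ Y := by
        rw [hY, le_div_iff₀ (by positivity)]
        nlinarith
  have hexp1 := Real.exp_one_lt_d9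
  have h9 : 1 + 8 ≤ l := by
    refine step 1 le_rfl hl1 8 ?_
    calc Real.exp 8 = Real.exp 1 ^ 8 := by rw [← Real.exp_nat_mul]; norm_num
      _ ≤ 2.7182818286 ^ 8 := by gcongr
      _ ≤ _ := by norm_num
  have h14 : 1 + 13 ≤ l := by
    refine step 9 (by norm_num) (by linarith) 13 ?_
    calc Real.exp 13 = Real.exp 1 ^ 13 := by rw [← Real.exp_nat_mul]; norm_num
      _ ≤ 2.7182818286 ^ 13 := by gcongr
      _ ≤ _ := by norm_num
  linarith

/-- For `m` of the order of the inverse radius, ILESS keeps the ball around the risk minimizer with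
probability more than `δ`. -/
theorem measure_not_subset_empLowErrorSet_lt {X : Type*} [MeasurableSpace X] {F : Set (X → Bool)}
    (hF : ∀ f ∈ F, Measurable f) {d : ℕ} (hVC : HasVCDim F d) (hd : 1 ≤ d)
    {P : Measure (X × Bool)} [IsProbabilityMeasure P] (hFP : PatternMeasurable F P.fst)
    {fstar : X → Bool} (hstar : IsTrueRiskMinimizer F P fstar) {m : ℕ} (hm : 1 ≤ m) {δ : ℝ}
    (hδ : 0 < δ) (hδ1 : δ < 1 / 24) (hmδ : m * δ ≤ 1 / 6) (hdδ : d * δ ≤ 16 * m)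
    (erm : (Fin m → X × Bool) → X → Bool) (herm : ∀ S, erm S ∈ F) :
    (Measure.pi fun _ : Fin m => P) {S | ¬ hypBall F P.fst fstar δ ⊆ empLowErrorSet F S (erm S)
      (ilessRadius m δ d (empRisk S (erm S)))} < ENNReal.ofReal (1 - δ) := by
  have hm' : (0 : ℝ) < m := by exact_mod_cast hm
  have hd' : (1 : ℝ) ≤ d := by exact_mod_cast hd
  have hballF : hypBall F P.fst fstar δ ⊆ F := fun f hf => hf.1
  by_cases ha : 1 / 2 ≤ slackBase m δ d
  · have : {S | ¬ hypBall F P.fst fstar δ ⊆ empLowErrorSet F S (erm S)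
      (ilessRadius m δ d (empRisk S (erm S)))} = ∅ := by
      ext S
      simp only [Set.mem_ofPred_eq, Set.mem_empty_iff_false, iff_false, not_not]
      exact subset_empLowErrorSet_of_half_le_slackBase hballF hm ha S _
    rw [this, measure_empty]
    exact ENNReal.ofReal_pos.2 (by linarith)
  set l := Real.log (16 * m * Real.exp 1 / (d * δ)) with hl
  set A := 4 * d * l with hA
  have hAm : A = m * slackBase m δ d := by
    unfold slackBase; rw [hA, hl]; field_simp
  have hAhalf : A ≤ m * (1 / 2) := by
    rw [hAm]; exact mul_le_mul_of_nonneg_left (not_le.1 ha).le hm'.le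
  have hl14 : 14 ≤ l := fourteen_le_log_of_slack hd hm hδ hmδ hdδ (by rw [← hl]; linarith)
  have hA54 : 54 ≤ A := by nlinarith
  have hd2m : d ≤ 2 * m := by
    have : (d : ℝ) ≤ 2 * m := by nlinarith
    exact_mod_cast this
  set N : ℝ := (Real.exp 1 * (2 * m : ℕ) / d) ^ d with hN
  have hgrowth : ∀ x : Fin m ⊕ Fin m → X, ((labellings F x).ncard : ℝ) ≤ N := by
    intro x
    have h1 := ncard_labellings_le F d hVC x
    rw [Fintype.card_sum, Fintype.card_fin, ← two_mul] at h1
    refine le_trans ?_ (sum_choose_le_exp_pow (2 * m) d hd hd2m)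
    exact_mod_cast h1
  have hβ : N * Real.exp (-A / 4) ≤ δ / 8 :=
    growth_mul_exp_neg_slack_le hm hd hδ (by linarith)
  have hmain := measure_not_comparable_le (ρ := δ) hF hFP hstar hA54 (by positivity) hmδ hgrowth
  refine lt_of_le_of_lt ((measure_mono ?_).trans hmain)
    ((ENNReal.ofReal_lt_ofReal_iff (by linarith)).2 (by linarith))
  intro S hS hS'
  refine hS fun f hf => ?_
  exact mem_empLowErrorSet_of_mistakeCount_le hm (by linarith) hAm hf.1 (hS' f hf _ (herm S))

/-- The upper bound on `d δ²` keeps the argument of the logarithm at least 2, so the logarithm is at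
least `1/2`; the lower bound gives `m ≤ 4 d`. -/
theorem half_le_slackBase {m d : ℕ} {δ : ℝ} (hm : 1 ≤ m) (hδ : 0 < δ) (hδ1 : δ < 1 / 24)
    (hmδ : m * δ ≤ 1) (hmδ' : 23 / 24 ≤ m * δ) (hd2 : 2 ≤ d * δ ^ 2) (hd16 : d * δ ^ 2 ≤ 16) :
    1 / 2 ≤ slackBase m δ d := by
  have hm' : (1 : ℝ) ≤ m := by exact_mod_cast hm
  have hd' : (0 : ℝ) < d := by
    by_contra h
    have : (d : ℝ) * δ ^ 2 ≤ 0 := mul_nonpos_of_nonpos_of_nonneg (not_lt.1 h) (sq_nonneg _)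
    linarith
  set Y := 16 * m * Real.exp 1 / (d * δ) with hY
  have hY2 : 2 ≤ Y := by
    rw [hY, le_div_iff₀ (by positivity)]
    have he := Real.exp_one_gt_d9
    refine le_of_mul_le_mul_right ?_ hδ
    calc 2 * (d * δ) * δ = 2 * (d * δ ^ 2) := by ring
      _ ≤ 16 * (23 / 24) * 2.7 := by linarith
      _ ≤ 16 * (m * δ) * Real.exp 1 := by gcongr; linarith
      _ = 16 * m * Real.exp 1 * δ := by ring
  have hlog : 1 / 2 ≤ Real.log Y := by
    have h1 := Real.one_sub_inv_le_log_of_pos (by linarith : 0 < Y)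
    have h2 : Y⁻¹ ≤ 2⁻¹ := inv_anti₀ (by norm_num) hY2
    linarith
  unfold slackBase
  rw [← hY, le_div_iff₀ (by linarith)]
  have h1 : (m : ℝ) ≤ 4 * d := by
    refine le_of_mul_le_mul_right ?_ (by positivity : 0 < δ ^ 2)
    calc (m : ℝ) * δ ^ 2 = (m * δ) * δ := by ring
      _ ≤ 1 * (1 / 24) := by gcongr
      _ ≤ 4 * (d * δ ^ 2) := by linarith
      _ = 4 * d * δ ^ 2 := by ring
  nlinarith

/-! ### Choice of the sample size and the confidence -/

theorem corollary1 {X : Type*} [MeasurableSpace X]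
    -- a class of measurable classifiers of finite VC dimension `d`, and a distribution `P`
    (F : Set (X → Bool)) (hF : ∀ f ∈ F, Measurable f)
    (d : ℕ) (hd : HasVCDim F d)
    (P : Measure (X × Bool)) [IsProbabilityMeasure P]
    (hFP : PatternMeasurable F P.fst)
    -- the empirical risk minimizers that ILESS uses: any choice of them
    (erm : (m : ℕ) → (Fin m → X × Bool) → X → Bool)
    (herm : ∀ (m : ℕ) (S : Fin m → X × Bool), 1 ≤ m → IsERM F S (erm m S))
    -- the polylogarithmic term; only its sign and its monotonicity matter
    (polylog : ℝ → ℕ → ℝ → ℝ)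
    (hnonneg : ∀ x y : ℝ, 0 < x → 0 < y → 0 ≤ polylog x d y)
    (hmono : ∀ x x' y y' : ℝ, 1 ≤ x → x ≤ x' → 1 ≤ y → y ≤ y' → polylog x d y ≤ polylog x' d y')
    (mmax : ℕ) (hmmax : 1 ≤ mmax)
    (habstain : ∀ m : ℕ, 1 ≤ m → m ≤ mmax → ∀ δ : ℝ, 0 < δ → δ < 1 →
      1 - δ ≤ (Measure.pi fun _ : Fin m => P).real
        {S | (iless S δ F d (erm m S)).abstainRate P.fst ≤ polylog m d (1 / δ) / m}) :
    ∀ fstar : X → Bool, IsTrueRiskMinimizer F P fstar →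
      ∀ r : ℝ, 1 / (mmax : ℝ) ≤ r → ((d : ℝ) * r ^ 2 ≤ 16 ∨ 1 / 24 ≤ r) →
        disagreementCoeff F P.fst fstar r
          ≤ ENNReal.ofReal (8 * (polylog (1 / r) d (1 / r) + 3)) := by
  intro fstar hstar r hr hdr
  have hmmax' : (0 : ℝ) < mmax := by exact_mod_cast hmmax
  have hr0 : 0 < r := lt_of_lt_of_le (by positivity) hr
  have hrmax : 1 / r ≤ mmax := (one_div_le hr0 hmmax').2 hr
  set q := polylog (1 / r) d (1 / r) with hq
  have hq0 : 0 ≤ q := hnonneg _ _ (by positivity) (by positivity)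
  refine iSup₂_le fun ρ hρ => ?_
  have hρ0 : 0 < ρ := hr0.trans hρ
  refine ENNReal.div_le_of_le_mul ?_
  rw [← ENNReal.ofReal_mul (by positivity)]
  -- The summand 3 serves this case: `8 * 3 * ρ ≥ 1`.
  by_cases hρ24 : 1 / 24 ≤ ρ
  · refine prob_le_one.trans ?_
    rw [← ENNReal.ofReal_one]
    exact ENNReal.ofReal_le_ofReal (by nlinarith)
  rw [not_le] at hρ24
  have hdr : (d : ℝ) * r ^ 2 ≤ 16 := hdr.resolve_right (by linarith)
  have hball : hypBall F P.fst fstar ρ ⊆ F := fun f hf => hf.1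
  rcases Nat.eq_zero_or_pos d with rfl | hd1
  · rw [disagreementSet_eq_empty_of_hasVCDim_zero hd hball, measure_empty]
    exact zero_le
  have hd' : (0 : ℝ) < d := by exact_mod_cast hd1
  -- It suffices to find `m` between `1 / (8ρ)` and `1 / r` and `δ ≥ r` with the inclusion: then `m
  -- ≤ mmax`, monotonicity bounds the polylogarithmic term by `q`, and `1 / m ≤ 8ρ`.
  have hchoose : ∀ (m : ℕ) (δ : ℝ), 1 ≤ m → r ≤ δ → δ < 1 → m * r ≤ 1 → 1 ≤ m * (8 * ρ) →
      (Measure.pi fun _ : Fin m => P) {S | ¬ hypBall F P.fst fstar ρ ⊆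
        empLowErrorSet F S (erm m S) (ilessRadius m δ d (empRisk S (erm m S)))}
          < ENNReal.ofReal (1 - δ) →
      P.fst (disagreementSet (hypBall F P.fst fstar ρ)) ≤ ENNReal.ofReal (8 * (q + 3) * ρ) := by
    intro m δ hm hrδ hδ1 hmr hmρ hlt
    have hm' : (1 : ℝ) ≤ m := by exact_mod_cast hm
    have hδ0 : 0 < δ := hr0.trans_le hrδ
    have hm1r : (m : ℝ) ≤ 1 / r := (le_div_iff₀ hr0).2 hmr
    have hmmx : m ≤ mmax := by exact_mod_cast hm1r.trans hrmax
    refine (measure_disagreementSet_le hFP (erm m) (habstain m hm hmmx δ hδ0 hδ1) hlt).trans ?_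
    refine ENNReal.ofReal_le_ofReal ?_
    have hpq : polylog m d (1 / δ) ≤ q := hmono _ _ _ _ hm' hm1r
      ((one_le_div hδ0).2 hδ1.le) (one_div_le_one_div_of_le hr0 hrδ)
    rw [div_le_iff₀ (by linarith)]
    nlinarith [mul_nonneg hq0 (by linarith : 0 ≤ m * (8 * ρ) - 1), mul_pos hρ0 (by linarith : (0 : ℝ) < m)]
  by_cases hdρ : (d : ℝ) * ρ ^ 2 ≤ 2
  · set m := ⌈1 / (8 * ρ)⌉₊ with hmdef
    have hm : 1 ≤ m := Nat.one_le_ceil_iff.2 (by positivity)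
    have hlow : 1 ≤ m * (8 * ρ) := (div_le_iff₀ (by positivity)).1 (Nat.le_ceil (1 / (8 * ρ)))
    have hup : m * ρ ≤ 1 / 6 := by
      have h1 : (m : ℝ) < 1 / (8 * ρ) + 1 := Nat.ceil_lt_add_one (by positivity)
      have h2 : (1 / (8 * ρ) + 1) * ρ = 1 / 8 + ρ := by field_simp
      have := mul_le_mul_of_nonneg_right h1.le hρ0.le
      linarith
    have hm' : (1 : ℝ) ≤ m := by exact_mod_cast hm
    refine hchoose m ρ hm hρ.le (by linarith) (by nlinarith) hlow ?_
    refine measure_not_subset_empLowErrorSet_lt hF hd hd1 hFP hstar hm hρ0 hρ24 hup ?_ _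
      fun S => (herm m S hm).1
    refine le_of_mul_le_mul_right ?_ hρ0
    calc (d : ℝ) * ρ * ρ = d * ρ ^ 2 := by ring
      _ ≤ 16 * m * ρ := by linarith
  · rw [not_le] at hdρ
    -- The cap `4 / √d` enforces `d δ² ≤ 16`, and `d r² ≤ 16` is exactly what keeps `r ≤ δ`.
    set δ := min ρ (4 / √d) with hδdef
    have hsd : 0 < √(d : ℝ) := Real.sqrt_pos.2 hd'
    have hsd2 : √(d : ℝ) ^ 2 = d := Real.sq_sqrt hd'.le
    have h4 : (d : ℝ) * (4 / √d) ^ 2 = 16 := by rw [div_pow, hsd2]; field_simp; norm_num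
    have hδ0 : 0 < δ := lt_min hρ0 (by positivity)
    have hδρ : δ ≤ ρ := min_le_left _ _
    have hrδ : r ≤ δ := by
      refine le_min hρ.le ((le_div_iff₀ hsd).2 ?_)
      refine abs_le_of_sq_le_sq' (a := r * √d) ?_ (by norm_num) |>.2
      rw [mul_pow, hsd2]; linarith
    have hd16 : d * δ ^ 2 ≤ 16 := by
      rw [← h4]; gcongr; exact min_le_right _ _
    have hd2 : 2 ≤ d * δ ^ 2 := by
      rcases min_choice ρ (4 / √(d : ℝ)) with h | h
      · rw [hδdef, h]; exact hdρ.le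
      · rw [hδdef, h, h4]; norm_num
    set m := ⌊1 / δ⌋₊ with hmdef
    have h1δ : 24 < 1 / δ := by rw [lt_div_iff₀ hδ0]; linarith
    have hm : 1 ≤ m := Nat.le_floor (by push_cast; linarith)
    have hm' : (1 : ℝ) ≤ m := by exact_mod_cast hm
    have hup : m * δ ≤ 1 := (le_div_iff₀ hδ0).1 (Nat.floor_le (by positivity))
    have hlow : 23 / 24 ≤ m * δ := by
      have h1 : 1 / δ < m + 1 := Nat.lt_floor_add_one _
      have h2 := (div_lt_iff₀ hδ0).1 h1
      linarith
    refine hchoose m δ hm hrδ (by linarith) ?_ ?_ ?_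
    · exact (mul_le_mul_of_nonneg_left hrδ (by linarith)).trans hup
    · have := mul_le_mul_of_nonneg_left hδρ (by linarith : (0 : ℝ) ≤ m)
      linarith
    · have ha := half_le_slackBase hm hδ0 (by linarith) hup hlow hd2 hd16
      have : {S | ¬ hypBall F P.fst fstar ρ ⊆ empLowErrorSet F S (erm m S)
          (ilessRadius m δ d (empRisk S (erm m S)))} = ∅ := by
        ext S
        simp only [Set.mem_ofPred_eq, Set.mem_empty_iff_false, iff_false, not_not]
        exact subset_empLowErrorSet_of_half_le_slackBase hball hm ha S _
      rw [this, measure_empty]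
      exact ENNReal.ofReal_pos.2 (by linarith)
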